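/- Let $M$ be a matroid of rank $r$ on the ground set $[n]$ that is paving, i.e. every circuit of $M$ has at least $r$ elements. A hyperplane of $M$ is a flat of rank $r-1$; for each $s$ let $\mathcal H_s$ be the set of hyperplanes of $M$ with exactly $s$ elements. For a matroid $N$ on $[n]$ let $\mathcal P_N=\operatorname{conv}\{\mathbf e_B : B \text{ a basis of } N\}\subset\mathbb R^n$ be its base polytope, where $\mathbf e_B=\sum_{i\in B}\mathbf e_i$, and let $\mathrm{ehr}_N(t)=|t\mathcal P_N\cap\mathbb Z^n|$ for integers $t\ge 0$. Let $U_{r,n}$ be the uniform matroid of rank $r$ on $[n]$, whose base polytope is the hypersimplex $\Delta_{r,n}$. Then for every integer $t\ge 0$ \[ \mathrm{ehr}_M(t)=\mathrm{ehr}_{U_{r,n}}(t)-\sum_{s=r}^{n-1}|\mathcal H_s|\sum_{m=0}^{t-1}\sum_{i=0}^{s-r}(-1)^i\binom{s}{i}\binom{t(s-r-i)+m+s-1-i}{s-1}\binom{m+n-s-1}{m}, \] and, if $r\ge 1$, \[ \mathrm{ehr}_{U_{r,n}}(t)=\sum_{j=0}^{r-1}(-1)^j\binom nj\binom{(r-j)t-j+n-1}{n-1}.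 \] (If $r=0$, then $M$ has no hyperplanes and the first formula reads $\mathrm{ehr}_M(t)=\mathrm{ehr}_{U_{0,n}}(t)$.) -/

import Mathlib

open scoped Pointwise

/-- The Ehrhart function of `P ⊆ ℝ^ι`: the number of integer points of the dilate `tP`. -/
noncomputable def ehrhart {ι : Type*} (P : Set (ι → ℝ)) (t : ℕ) : ℕ :=
  {z : ι → ℤ | (fun i => (z i : ℝ)) ∈ (t : ℝ) • P}.ncard

namespace Matroid

variable {α : Type*}

/-- The base polytope of `M`: the convex hull of the indicator vectors of the bases of `M`. -/
noncomputable def basePolytope (M : Matroid α) : Set (α → ℝ) :=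
  convexHull ℝ {x | ∃ B : Set α, M.IsBase B ∧ x = B.indicator 1}

/-- The Ehrhart function of a matroid is that of its base polytope. -/
noncomputable def ehr (M : Matroid α) (t : ℕ) : ℕ := ehrhart M.basePolytope t

/-- A matroid is paving if every circuit has at least `rank M` elements. -/
def IsPaving (M : Matroid α) : Prop := ∀ C : Set α, M.IsCircuit C → M.eRank ≤ C.encard

/-- A hyperplane is a flat of rank `rank M - 1` (so there is none if `M` has rank `0`). -/
def IsHyperplane (M : Matroid α) (H : Set α) : Prop := M.IsFlat H ∧ M.eRk H + 1 = M.eRank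

/-- The number `|ℋ_s|` of hyperplanes of `M` with exactly `s` elements. -/
noncomputable def numHyperplanes (M : Matroid α) (s : ℕ) : ℕ :=
  {H : Set α | M.IsHyperplane H ∧ H.encard = s}.ncard

/-- The uniform matroid `U_{r,n}`, on `Fin n`: the independent sets are the sets with at most
`r` elements. -/
def uniform (r n : ℕ) : Matroid (Fin n) :=
  (IndepMatroid.ofFinite (E := Set.univ) Set.finite_univ (fun I => I.ncard ≤ r)
    (by simp)
    (fun _ _ hJ hIJ => (Set.ncard_le_ncard hIJ (Set.toFinite _)).trans hJ)
    (fun I J _ hJ hIJ => by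
      obtain ⟨e, heJ, heI⟩ := Set.exists_mem_notMem_of_ncard_lt_ncard hIJ (Set.toFinite _)
      exact ⟨e, heJ, heI, (Set.ncard_insert_le e I).trans (by omega)⟩)
    (fun _ _ => Set.subset_univ _)).matroid

theorem uniform_indep_iff {r n : ℕ} {I : Set (Fin n)} : (uniform r n).Indep I ↔ I.ncard ≤ r := by
  simp [uniform, IndepMatroid.ofFinite]

/-- For `r ≤ n` the bases of `U_{r,n}` are the `r`-element sets. -/
theorem uniform_isBase_iff {r n : ℕ} (h : r ≤ n) {B : Set (Fin n)} :
    (uniform r n).IsBase B ↔ B.ncard = r := by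
  rw [isBase_iff_maximal_indep, maximal_subset_iff]
  simp only [uniform_indep_iff]
  constructor
  · rintro ⟨h1, h2⟩
    by_contra hne
    have hlt : B.ncard < (Set.univ : Set (Fin n)).ncard := by
      rw [Set.ncard_univ, Nat.card_fin]; omega
    obtain ⟨e, -, he⟩ := Set.exists_mem_notMem_of_ncard_lt_ncard hlt (Set.toFinite _)
    have hi := h2 (t := insert e B) ((Set.ncard_insert_le e B).trans (by omega))
      (Set.subset_insert e B)
    exact he (hi ▸ Set.mem_insert e B)
  · intro hB
    exact ⟨hB.le, fun t ht hBt => Set.eq_of_subset_of_ncard_le hBt (by omega) (Set.toFinite _)⟩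

end Matroid

/-! By Edmonds' rank inequalities, the base polytope of a paving matroid is the hypersimplex cut by
x(H) ≤ r - 1 for the hyperplanes H with at least r elements (`IsPaving.mem_smul_basePolytope_iff`).
Distinct hyperplanes meet in at most r - 2 elements, so no point of the dilated hypersimplex
violates two of these inequalities (`IsPaving.eq_of_not_le`), and the lattice points cut off are
counted one hyperplane at a time. For |H| = s, a point cut off has sum m < t outside H, where the
upper bound t is automatic; this gives the last binomial. Reflecting y = t - x on H turns the sum
over H into t(s - r) + m, and inclusion-exclusion in the box gives the alternating sum. -/

/-- Abel summation: the sum is a nonnegative combination of sums of `y` over upper level sets of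
`w`. The induction peels off an element of least weight and raises `m` to that weight. -/
theorem sum_weight_sub_mul_nonneg {ι : Type*} [DecidableEq ι] (w y : ι → ℝ) (S : Finset ι) :
    ∀ m : ℝ, (∀ i ∈ S, m ≤ w i) → (∀ c, m < c → 0 ≤ ∑ i ∈ S with c ≤ w i, y i) →
      0 ≤ ∑ i ∈ S, (w i - m) * y i := by
  induction S using Finset.induction_on_min_value w with
  | empty => simp
  | insert a S ha hmin ih =>
    intro m hm hc
    have hskip : ∀ c, w a < c → 0 ≤ ∑ i ∈ S with c ≤ w i, y i := by
      intro c hac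
      have := hc c ((hm a (Finset.mem_insert_self a S)).trans_lt hac)
      rwa [Finset.filter_insert, if_neg (not_le.2 hac)] at this
    have key := ih (w a) hmin hskip
    have hall : 0 ≤ (w a - m) * ∑ i ∈ insert a S, y i := by
      rcases (hm a (Finset.mem_insert_self a S)).eq_or_lt with h | h
      · simp [h]
      · refine mul_nonneg (by linarith) ?_
        have := hc (w a) h
        rwa [Finset.filter_true_of_mem] at this
        intro i hi
        rcases Finset.mem_insert.1 hi with rfl | hi
        · exact le_rfl
        · exact hmin i hi
    have : ∑ i ∈ insert a S, (w i - m) * y i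
        = ∑ i ∈ S, (w i - w a) * y i + (w a - m) * ∑ i ∈ insert a S, y i := by
      rw [Finset.sum_insert ha, Finset.sum_insert ha, mul_add, Finset.mul_sum, add_left_comm,
        ← Finset.sum_add_distrib]
      congr 1
      exact Finset.sum_congr rfl fun i _ => by ring
    rw [this]
    exact add_nonneg key hall

/-! ### Edmonds' inequalities for the base polytope. -/

namespace Matroid

variable {α : Type*}

open Classical in
/-- A base of maximum weight meets every upper level set of the weight in a basis of it. -/
theorem exists_isBase_isBasis_levels [Fintype α] (M : Matroid α) (hE : M.E = Set.univ)
    (w : α → ℝ) :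
    ∃ B, M.IsBase B ∧ ∀ c, M.IsBasis (B ∩ {i | c ≤ w i}) {i | c ≤ w i} := by
  obtain ⟨B, hB, hmax⟩ := (Set.toFinite {B | M.IsBase B}).exists_maximalFor
    (fun B => ∑ i ∈ B.toFinset, w i) _ M.exists_isBase
  refine ⟨B, hB, fun c => ?_⟩
  have hI : M.Indep (B ∩ {i | c ≤ w i}) := hB.indep.subset Set.inter_subset_left
  refine hI.isBasis_of_forall_insert Set.inter_subset_right fun e he => ?_
  rw [Matroid.dep_iff]
  refine ⟨fun hind => ?_, by simp [hE]⟩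
  have heB : e ∉ B := fun h => he.2 ⟨h, he.1⟩
  obtain ⟨B', hB', hIB', hB'B⟩ := hind.exists_isBase_subset_union_isBase hB
  have hsub : B' ⊆ insert e B := hB'B.trans (by
    rw [Set.insert_union, Set.union_eq_self_of_subset_left Set.inter_subset_left])
  have heB' : e ∈ B' := hIB' (Set.mem_insert _ _)
  have hcard : B.encard = B'.encard := hB.encard_eq_encard_of_isBase hB'
  obtain ⟨f, hf, hfB'⟩ : ∃ f ∈ B, f ∉ B' := by
    by_contra! h
    have hss : insert e B ⊆ B' := Set.insert_subset heB' h
    have h1 := Set.encard_le_encard hss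
    rw [Set.encard_insert_of_notMem heB, ← hcard] at h1
    exact absurd h1 (not_le.2
      ((ENat.lt_add_one_iff (Set.encard_ne_top_iff.2 (Set.toFinite B))).2 le_rfl))
  -- `B'` is `B` with `f` exchanged for `e`. Since `f` must lie below level `c` and `e` does not,
  -- `B'` would be heavier than `B`.
  have hEq : insert f B' = insert e B := by
    apply Set.eq_of_subset_of_ncard_le (Set.insert_subset (Set.mem_insert_of_mem _ hf) hsub) _
      (Set.toFinite _)
    rw [Set.ncard_insert_of_notMem hfB', Set.ncard_insert_of_notMem heB, Set.ncard, Set.ncard,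
      hcard]
  have hwf : w f < c := by
    by_contra! h
    exact hfB' (hIB' (Set.mem_insert_of_mem _ ⟨hf, h⟩))
  have hsum : w f + ∑ i ∈ B'.toFinset, w i = w e + ∑ i ∈ B.toFinset, w i := by
    rw [← Finset.sum_insert (by simpa using hfB'), ← Finset.sum_insert (by simpa using heB)]
    refine Finset.sum_congr ?_ fun _ _ => rfl
    rw [← Set.toFinset_insert, ← Set.toFinset_insert]
    exact Set.toFinset_congr hEq
  have hce : c ≤ w e := he.1
  have := hmax hB' (by dsimp only; linarith)
  dsimp only at this
  linarith

theorem finite_setOf_isBase_indicator [Finite α] (M : Matroid α) :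
    {x : α → ℝ | ∃ B : Set α, M.IsBase B ∧ x = B.indicator 1}.Finite :=
  (Set.finite_range fun B : Set α => B.indicator (1 : α → ℝ)).subset
    (by rintro _ ⟨B, -, rfl⟩; exact ⟨B, rfl⟩)

open Classical in
/-- The rank inequalities cut out the base polytope (Edmonds). -/
theorem mem_smul_basePolytope_of_rank_le [Fintype α] (M : Matroid α) (hE : M.E = Set.univ)
    (t : ℝ) (x : α → ℝ)
    (hle : ∀ I A : Set α, M.IsBasis I A → ∑ i with i ∈ A, x i ≤ t * I.ncard)
    (heq : ∀ B, M.IsBase B → ∑ i, x i = t * B.ncard) :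
    x ∈ t • M.basePolytope := by
  by_contra hx
  have hconv : Convex ℝ (t • M.basePolytope) := (convex_convexHull ℝ _).smul t
  have hclosed : IsClosed (t • M.basePolytope) :=
    ((M.finite_setOf_isBase_indicator.isCompact_convexHull ℝ).smul t).isClosed
  -- A functional separating `x` from the polytope is contradicted at the greedy base for its
  -- weights `w`.
  obtain ⟨f, u, hfu, hux⟩ := geometric_hahn_banach_closed_point hconv hclosed hx
  set w : α → ℝ := fun i => f (Pi.single i 1) with hw
  have hf : ∀ z : α → ℝ, f z = ∑ i, w i * z i := by
    intro z
    have hz : z = ∑ i, z i • (Pi.single i 1 : α → ℝ) := by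
      ext j
      simp [Finset.sum_apply, Pi.single_apply]
    conv_lhs => rw [hz]
    simp [map_sum, hw, mul_comm]
  obtain ⟨B, hB, hbasis⟩ := M.exists_isBase_isBasis_levels hE w
  have hmem : t • (B.indicator 1 : α → ℝ) ∈ t • M.basePolytope :=
    Set.smul_mem_smul_set (subset_convexHull ℝ _ ⟨B, hB, rfl⟩)
  have hlt := (hfu _ hmem).trans hux
  -- Shifting the weights by `m` costs nothing: both points have the same coordinate sum.
  obtain ⟨m, hm⟩ := (Set.finite_range w).bddBelow
  have hind : ∀ S : Finset α, ∑ i ∈ S, (t • (B.indicator 1 : α → ℝ)) i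
      = t * (B ∩ S).ncard := by
    intro S
    have : (B ∩ S) = ((S.filter (· ∈ B) : Finset α) : Set α) := by
      ext; simp [and_comm]
    rw [this, Set.ncard_coe_finset]
    simp [Set.indicator_apply, ← Finset.sum_filter, mul_comm]
  have hlayer := sum_weight_sub_mul_nonneg w
    (fun i => (t • (B.indicator 1 : α → ℝ)) i - x i) Finset.univ m
    (fun i _ => hm ⟨i, rfl⟩) (fun c _ => by
      rw [Finset.sum_sub_distrib, hind]
      have := hle _ _ (hbasis c)
      simp only [Set.mem_ofPred_eq] at this
      simp only [Finset.coe_filter, Finset.mem_univ, true_and]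
      linarith)
  have hzero : ∑ i, ((t • (B.indicator 1 : α → ℝ)) i - x i) = 0 := by
    rw [Finset.sum_sub_distrib, hind, heq B hB]
    simp
  have hsplit : ∑ i, (w i - m) * ((t • (B.indicator 1 : α → ℝ)) i - x i)
      = f (t • (B.indicator 1 : α → ℝ)) - f x
        - m * ∑ i, ((t • (B.indicator 1 : α → ℝ)) i - x i) := by
    rw [hf, hf, Finset.mul_sum, ← Finset.sum_sub_distrib, ← Finset.sum_sub_distrib]
    exact Finset.sum_congr rfl fun i _ => by ring
  rw [hsplit, hzero] at hlayer
  linarith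

/-- A linear inequality that holds at the bases holds on the dilated base polytope. -/
theorem le_of_mem_smul_basePolytope {M : Matroid α} {t : ℝ} (ht : 0 ≤ t)
    (f : (α → ℝ) →ₗ[ℝ] ℝ) {b : ℝ} (hb : ∀ B, M.IsBase B → f (B.indicator 1) ≤ b)
    {x : α → ℝ} (hx : x ∈ t • M.basePolytope) : f x ≤ t * b := by
  obtain ⟨y, hy, rfl⟩ := hx
  have : f y ≤ b := by
    refine convexHull_min (t := {z | f z ≤ b}) ?_ (convex_halfSpace_le f.isLinear b) hy
    rintro _ ⟨B, hB, rfl⟩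
    exact hb B hB
  simpa using mul_le_mul_of_nonneg_left this ht

/-! ### Hyperplanes of paving matroids. -/

section paving

variable {M : Matroid α} {r : ℕ}

theorem IsPaving.indep_of_encard_lt (hM : M.IsPaving) (hE : M.E = Set.univ) {I : Set α}
    (hI : I.encard < M.eRank) : M.Indep I := by
  by_contra h
  obtain ⟨C, hCI, hC⟩ := (M.not_indep_iff (by simp [hE])).1 h |>.exists_isCircuit_subset
  exact absurd ((hM C hC).trans (Set.encard_le_encard hCI)) (not_le.2 hI)

/-- In a paving matroid a set is independent, or spanning, or contained in a hyperplane with at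
least `r` elements. -/
theorem IsPaving.basis_cases [Finite α] (hM : M.IsPaving) (hE : M.E = Set.univ)
    (hr : M.eRank = r) {I A : Set α} (hI : M.IsBasis I A) :
    I = A ∨ I.ncard = r ∨
      (I.ncard + 1 = r ∧ ∃ H, M.IsHyperplane H ∧ r ≤ H.ncard ∧ A ⊆ H) := by
  by_cases hIA : I = A
  · exact Or.inl hIA
  obtain ⟨e, heA, heI⟩ := Set.exists_of_ssubset (hI.subset.ssubset_of_ne hIA)
  have hdep : M.Dep (insert e I) := hI.insert_dep ⟨heA, heI⟩
  have h1 : r ≤ I.ncard + 1 := by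
    by_contra! h
    refine hdep.not_indep (hM.indep_of_encard_lt hE ?_)
    rw [hr, Set.encard_insert_of_notMem heI, ← (Set.toFinite I).cast_ncard_eq]
    exact_mod_cast h
  have h2 : I.ncard ≤ r := by
    have := hI.indep.encard_le_eRank
    rw [hr, ← (Set.toFinite I).cast_ncard_eq] at this
    exact_mod_cast this
  rcases h2.eq_or_lt with h | h
  · exact Or.inr (Or.inl h)
  have h3 : I.ncard + 1 = r := by omega
  refine Or.inr (Or.inr ⟨h3, M.closure A, ⟨M.isFlat_closure A, ?_⟩, ?_, ?_⟩)
  · rw [eRk_closure_eq, hI.eRk_eq_encard, hr, ← (Set.toFinite I).cast_ncard_eq]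
    exact_mod_cast h3
  · have hss : insert e I ⊆ M.closure A :=
      (Set.insert_subset heA hI.subset).trans (M.subset_closure A (by simp [hE]))
    have := Set.ncard_le_ncard hss (Set.toFinite _)
    rwa [Set.ncard_insert_of_notMem heI, h3] at this
  · exact M.subset_closure A (by simp [hE])

theorem IsHyperplane.one_le (hr : M.eRank = r) {H : Set α} (hH : M.IsHyperplane H) : 1 ≤ r := by
  have := hH.2
  rw [hr] at this
  have h' : (1 : ℕ∞) ≤ r := this ▸ le_add_self
  exact_mod_cast h'

/-- Otherwise H ∩ K contains a set of r - 1 elements. Paving makes it independent, hence a basis of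
both H and K, and both flats equal its closure. -/
theorem IsHyperplane.ncard_inter_le [Finite α] (hM : M.IsPaving) (hE : M.E = Set.univ)
    (hr : M.eRank = r) {H K : Set α} (hH : M.IsHyperplane H) (hK : M.IsHyperplane K)
    (hHK : H ≠ K) : (H ∩ K).ncard + 2 ≤ r := by
  by_contra! h
  have hr1 : 1 ≤ r := hH.one_le hr
  obtain ⟨I, hI, hIc⟩ := Set.exists_subset_card_eq (s := H ∩ K) (n := r - 1) (by omega)
  have hIe : I.encard + 1 = M.eRank := by
    rw [hr, ← (Set.toFinite I).cast_ncard_eq, hIc]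
    exact_mod_cast Nat.sub_add_cancel hr1
  have hind : M.Indep I := by
    refine hM.indep_of_encard_lt hE ?_
    rw [← hIe]
    exact (ENat.lt_add_one_iff (Set.encard_ne_top_iff.2 (Set.toFinite I))).2 le_rfl
  have hcl : ∀ F, M.IsHyperplane F → I ⊆ F → M.closure I = F := by
    intro F hF hIF
    have hb : M.IsBasis I F := by
      refine hind.isBasis_of_eRk_ge (Set.toFinite _) hIF ?_ (by simp [hE])
      have : M.eRk F + 1 = M.eRk I + 1 := by rw [hF.2, hind.eRk_eq_encard, hIe]
      exact ((WithTop.add_right_cancel ENat.one_ne_top this)).le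
    rw [hb.closure_eq_closure, hF.1.closure]
  exact hHK ((hcl H hH (hI.trans Set.inter_subset_left)).symm.trans
    (hcl K hK (hI.trans Set.inter_subset_right)))

end paving

end Matroid

/-- The lattice points of the box `[0, t]^ι` with coordinate sum `k`. -/
def boxSlice (ι : Type*) [Fintype ι] [DecidableEq ι] (t k : ℕ) : Finset (ι → ℕ) :=
  {x ∈ Fintype.piFinset fun _ => Finset.range (t + 1) | ∑ i, x i = k}

theorem mem_boxSlice {ι : Type*} [Fintype ι] [DecidableEq ι] {t k : ℕ} {x : ι → ℕ} :
    x ∈ boxSlice ι t k ↔ (∀ i, x i ≤ t) ∧ ∑ i, x i = k := by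
  simp [boxSlice]

/-! ### Lattice points of the dilated base polytope. -/

namespace Matroid

variable {α : Type*} {M : Matroid α} {r : ℕ}

open Classical in
/-- The base polytope of a paving matroid is cut out of the hypersimplex by the hyperplanes with
at least `r` elements. -/
theorem IsPaving.mem_smul_basePolytope_iff [Fintype α] (hM : M.IsPaving) (hE : M.E = Set.univ)
    (hr : M.eRank = r) (t : ℕ) (x : α → ℝ) :
    x ∈ (t : ℝ) • M.basePolytope ↔ (∀ i, 0 ≤ x i) ∧ (∀ i, x i ≤ t) ∧ ∑ i, x i = t * r ∧
      ∀ H : Finset α, M.IsHyperplane H → r ≤ H.card → ∑ i ∈ H, x i + t ≤ t * r := by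
  have hBr : ∀ B, M.IsBase B → B.ncard = r := by
    intro B hB
    have := hB.encard_eq_eRank
    rw [hr, ← (Set.toFinite B).cast_ncard_eq] at this
    exact_mod_cast this
  have ht : (0 : ℝ) ≤ t := Nat.cast_nonneg t
  constructor
  · intro hx
    have hsum : ∀ (S : Finset α) (B : Set α),
        ∑ i ∈ S, (B.indicator 1 : α → ℝ) i = (B ∩ S).ncard := by
      intro S B
      have : (B ∩ S) = ((S.filter (· ∈ B) : Finset α) : Set α) := by
        ext; simp [and_comm]
      rw [this, Set.ncard_coe_finset]
      simp [Set.indicator_apply]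
    have hlin : ∀ (S : Finset α) (b : ℝ), (∀ B, M.IsBase B → ((B ∩ S).ncard : ℝ) ≤ b) →
        ∑ i ∈ S, x i ≤ t * b := by
      intro S b hb
      have := le_of_mem_smul_basePolytope (b := b) ht
        (∑ i ∈ S, LinearMap.proj i : (α → ℝ) →ₗ[ℝ] ℝ) (fun B hB => by
          simpa only [LinearMap.sum_apply, LinearMap.proj_apply, hsum] using hb B hB) hx
      simpa only [LinearMap.sum_apply, LinearMap.proj_apply] using this
    have hlin' : ∀ (S : Finset α) (b : ℝ), (∀ B, M.IsBase B → b ≤ ((B ∩ S).ncard : ℝ)) →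
        t * b ≤ ∑ i ∈ S, x i := by
      intro S b hb
      have := le_of_mem_smul_basePolytope (b := -b) ht
        (-∑ i ∈ S, LinearMap.proj i : (α → ℝ) →ₗ[ℝ] ℝ) (fun B hB => by
          simpa only [LinearMap.neg_apply, LinearMap.sum_apply, LinearMap.proj_apply, hsum,
            neg_le_neg_iff] using hb B hB) hx
      simp only [LinearMap.neg_apply, LinearMap.sum_apply, LinearMap.proj_apply] at this
      linarith
    refine ⟨fun i => ?_, fun i => ?_, le_antisymm ?_ ?_, fun H hH hrH => ?_⟩
    · simpa using hlin' {i} 0 (fun _ _ => Nat.cast_nonneg _)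
    · have := hlin {i} 1 (fun B _ => by
        have := Set.ncard_le_ncard (Set.inter_subset_right (s := B) (t := {i})) (Set.toFinite _)
        rw [Set.ncard_singleton] at this
        simpa using this)
      simpa using this
    · exact hlin Finset.univ r (fun B hB => by simp [hBr B hB])
    · exact hlin' Finset.univ r (fun B hB => by simp [hBr B hB])
    · have := hlin H (r - 1) (fun B hB => by
        have h1 : (B ∩ H).encard + 1 ≤ r := by
          rw [← hr, ← hH.2]
          gcongr
          exact (hB.indep.subset Set.inter_subset_left).encard_le_eRk_of_subset
            Set.inter_subset_right
        rw [← (Set.toFinite (B ∩ H)).cast_ncard_eq] at h1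
        have h2 : (B ∩ H).ncard + 1 ≤ r := by exact_mod_cast h1
        have h3 : ((B ∩ H).ncard : ℝ) + 1 ≤ r := by exact_mod_cast h2
        linarith)
      linarith
  · rintro ⟨h0, h1, hs, hH⟩
    refine M.mem_smul_basePolytope_of_rank_le hE t x (fun I A hI => ?_)
      (fun B hB => by rw [hBr B hB, hs])
    rcases hM.basis_cases hE hr hI with rfl | h | ⟨h, H, hHyp, hrH, hAH⟩
    · calc ∑ i with i ∈ I, x i ≤ ∑ i with i ∈ I, (t : ℝ) := Finset.sum_le_sum fun i _ => h1 i
        _ = t * I.ncard := by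
          rw [Finset.sum_const, nsmul_eq_mul, mul_comm, ← Set.ncard_coe_finset]
          simp
    · rw [h, ← hs]
      exact Finset.sum_le_sum_of_subset_of_nonneg (Finset.filter_subset _ _) fun i _ _ => h0 i
    · have := hH H.toFinset (by simpa using hHyp) (by rwa [← Set.ncard_eq_toFinset_card'])
      have h2 : ∑ i with i ∈ A, x i ≤ ∑ i ∈ H.toFinset, x i :=
        Finset.sum_le_sum_of_subset_of_nonneg (fun i hi => by
          simpa using hAH (Finset.mem_filter.1 hi).2) fun i _ _ => h0 i
      have h3 : (I.ncard : ℝ) + 1 = r := by exact_mod_cast h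
      have h4 : (t : ℝ) * r = t * I.ncard + t := by rw [← h3]; ring
      linarith

open Classical in
theorem IsPaving.ehr_eq_card [Fintype α] [DecidableEq α] (hM : M.IsPaving) (hE : M.E = Set.univ)
    (hr : M.eRank = r) (t : ℕ) :
    M.ehr t = ((boxSlice α t (t * r)).filter fun x =>
      ∀ H : Finset α, M.IsHyperplane H → r ≤ H.card → ∑ i ∈ H, x i + t ≤ t * r).card := by
  rw [ehr, ehrhart, ← Set.ncard_coe_finset,
    ← Set.ncard_image_of_injective (f := fun (x : α → ℕ) i => (x i : ℤ)) _
      (fun x y h => funext fun i => Int.ofNat_injective (congrFun h i))]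
  congr 1
  ext z
  simp only [Set.mem_ofPred_eq, hM.mem_smul_basePolytope_iff hE hr, Set.mem_image,
    Finset.coe_filter, mem_boxSlice]
  constructor
  · rintro ⟨h0, h1, hs, hH⟩
    have hz : ∀ i, ((z i).toNat : ℤ) = z i := fun i =>
      Int.toNat_of_nonneg (by exact_mod_cast h0 i)
    refine ⟨fun i => (z i).toNat, ⟨⟨fun i => ?_, ?_⟩, fun H hHy hrH => ?_⟩, funext hz⟩
    · have : z i ≤ t := by exact_mod_cast h1 i
      have := hz i
      dsimp only
      omega
    · have : ∑ i, z i = t * r := by exact_mod_cast hs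
      zify
      simpa only [hz] using this
    · have : ∑ i ∈ H, z i + t ≤ t * r := by exact_mod_cast hH H hHy hrH
      zify
      simpa only [hz] using this
  · rintro ⟨x, ⟨⟨h1, hs⟩, hH⟩, rfl⟩
    refine ⟨fun i => by positivity, fun i => by simpa using h1 i, by exact_mod_cast hs,
      fun H hHy hrH => by exact_mod_cast hH H hHy hrH⟩

theorem eRank_uniform {r n : ℕ} (h : r ≤ n) : (uniform r n).eRank = r := by
  obtain ⟨B, hB⟩ := (uniform r n).exists_isBase
  rw [← hB.encard_eq_eRank, ← (Set.toFinite B).cast_ncard_eq, (uniform_isBase_iff h).1 hB]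

theorem isPaving_uniform {r n : ℕ} (h : r ≤ n) : (uniform r n).IsPaving := by
  intro C hC
  have := hC.not_indep
  rw [uniform_indep_iff] at this
  rw [eRank_uniform h, ← (Set.toFinite C).cast_ncard_eq]
  exact_mod_cast (not_le.1 this).le

theorem IsHyperplane.ncard_lt_of_uniform {r n : ℕ} (h : r ≤ n) {H : Set (Fin n)}
    (hH : (uniform r n).IsHyperplane H) : H.ncard < r := by
  by_contra! hlt
  obtain ⟨I, hI, hIc⟩ := Set.exists_subset_card_eq (s := H) (n := r) hlt
  have h1 := (uniform_indep_iff.2 hIc.le).encard_le_eRk_of_subset hI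
  have h2 := hH.2
  rw [eRank_uniform h] at h2
  rw [← (Set.toFinite I).cast_ncard_eq, hIc, ← h2] at h1
  refine absurd h1 (not_le.2 ((ENat.lt_add_one_iff ?_).2 le_rfl))
  exact fun htop => by simp [htop] at h2

/-- The uniform matroid is itself paving, and its hyperplanes are too small to impose an inequality.
-/
theorem ehr_uniform {r n : ℕ} (h : r ≤ n) (t : ℕ) :
    (uniform r n).ehr t = (boxSlice (Fin n) t (t * r)).card := by
  classical
  rw [(isPaving_uniform h).ehr_eq_card rfl (eRank_uniform h) t, Finset.filter_true_of_mem]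
  intro x _ H hH hrH
  have := hH.ncard_lt_of_uniform h
  rw [Set.ncard_coe_finset] at this
  omega

end Matroid

/-! ### Counting lattice points in slices of a box. -/

theorem card_boxSlice_eq_coeff (ι : Type*) [Fintype ι] [DecidableEq ι] (t k : ℕ) :
    ((boxSlice ι t k).card : ℤ)
      = PowerSeries.coeff k ((∑ j ∈ Finset.range (t + 1), (PowerSeries.X : PowerSeries ℤ) ^ j)
          ^ Fintype.card ι) := by
  rw [← Finset.card_univ, ← Finset.prod_const, Finset.prod_univ_sum, map_sum]
  simp only [Finset.prod_pow_eq_pow_sum, PowerSeries.coeff_X_pow, boxSlice]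
  simp [eq_comm]

/-- Inclusion-exclusion count of the lattice points of a slice of a box. -/
theorem card_boxSlice (ι : Type*) [Fintype ι] [DecidableEq ι] (t k s : ℕ)
    (hs : Fintype.card ι = s + 1) :
    ((boxSlice ι t k).card : ℤ) = ∑ i ∈ Finset.range (s + 2),
      (-1 : ℤ) ^ i * ((s + 1).choose i : ℤ) *
        if i * (t + 1) ≤ k then ((s + (k - i * (t + 1))).choose s : ℤ) else 0 := by
  have hgeom : (∑ j ∈ Finset.range (t + 1), (PowerSeries.X : PowerSeries ℤ) ^ j)
      -- `PowerSeries.mk 1` is the geometric series 1/(1 - X).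
      = (1 - PowerSeries.X ^ (t + 1)) * PowerSeries.mk 1 := by
    rw [← mul_neg_geom_sum, mul_comm (1 - PowerSeries.X), mul_assoc,
      mul_comm (1 - PowerSeries.X), PowerSeries.mk_one_mul_one_sub_eq_one, mul_one]
  have hbin : (1 - (PowerSeries.X : PowerSeries ℤ) ^ (t + 1)) ^ (s + 1)
      = ∑ i ∈ Finset.range (s + 2), PowerSeries.C ((-1 : ℤ) ^ i * ((s + 1).choose i : ℤ)) *
          PowerSeries.X ^ (i * (t + 1)) := by
    rw [sub_eq_neg_add, add_pow]
    refine Finset.sum_congr rfl fun i _ => ?_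
    rw [neg_pow, ← pow_mul, mul_comm (t + 1) i]
    simp
    ring
  rw [card_boxSlice_eq_coeff, hs, hgeom, mul_pow, hbin, PowerSeries.mk_one_pow_eq_mk_choose_add,
    Finset.sum_mul, map_sum]
  refine Finset.sum_congr rfl fun i _ => ?_
  rw [mul_assoc, PowerSeries.coeff_C_mul, PowerSeries.coeff_X_pow_mul', PowerSeries.coeff_mk]

/-- For k ≤ t the upper bounds never bind, so only the term i = 0 survives. -/
theorem card_boxSlice_of_le (ι : Type*) [Fintype ι] [DecidableEq ι] (t k s : ℕ)
    (hs : Fintype.card ι = s + 1) (hk : k ≤ t) :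
    (boxSlice ι t k).card = (k + s).choose k := by
  zify
  rw [card_boxSlice ι t k s hs, Finset.sum_eq_single 0]
  · simp [add_comm s k, ← Nat.choose_symm_add]
  · intro i _ hi
    have : ¬ i * (t + 1) ≤ k := by
      have := Nat.le_mul_of_pos_left (t + 1) (Nat.pos_of_ne_zero hi)
      omega
    simp [this]
  · simp

/-- Reflecting the coordinates in `H` splits the points of a box whose sums over `H` and over its
complement are prescribed. -/
theorem card_filter_boxSlice {ι : Type*} [Fintype ι] [DecidableEq ι] (H : Finset ι)
    {t K k m : ℕ} (hK : K + k = t * H.card + m) :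
    ((boxSlice ι t K).filter fun x => ∑ i with i ∉ H, x i = m).card
      = (boxSlice {i // i ∈ H} t k).card * (boxSlice {i // i ∉ H} t m).card := by
  have hsplit : ∀ x : ι → ℕ, ∑ i, x i = ∑ i : {i // i ∈ H}, x i + ∑ i : {i // i ∉ H}, x i :=
    fun x => by
      rw [← Fintype.sum_subtype_add_sum_subtype (· ∈ H) x]
      congr!
  have hcompl : ∀ x : ι → ℕ, ∑ i with i ∉ H, x i = ∑ i : {i // i ∉ H}, x i := fun x =>
    (Finset.sum_subtype _ (by simp) x)
  have hrefl : ∀ y : {i // i ∈ H} → ℕ, (∀ i, y i ≤ t) →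
      ∑ i, (t - y i) + ∑ i, y i = t * H.card := by
    intro y hy
    rw [← Finset.sum_add_distrib, Finset.sum_congr rfl fun i _ => Nat.sub_add_cancel (hy i)]
    simp [mul_comm]
  rw [← Finset.card_product]
  refine Finset.card_nbij' (fun x => (fun i => t - x i, fun i => x i))
    (fun p i => if h : i ∈ H then t - p.1 ⟨i, h⟩ else p.2 ⟨i, h⟩) ?_ ?_ ?_ ?_
  · intro x hx
    simp only [Finset.coe_filter, Set.mem_ofPred_eq, mem_boxSlice, hcompl] at hx
    obtain ⟨⟨h1, h2⟩, h3⟩ := hx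
    have := hrefl (fun i => x i) (fun i => h1 i)
    have := hsplit x
    simp only [Finset.coe_product, Set.mem_prod, Finset.mem_coe, mem_boxSlice]
    exact ⟨⟨fun i => Nat.sub_le _ _, by omega⟩, fun i => h1 i, h3⟩
  · rintro ⟨y, z⟩ hp
    simp only [Finset.coe_product, Set.mem_prod, Finset.mem_coe, mem_boxSlice] at hp
    obtain ⟨⟨h1, h2⟩, h3, h4⟩ := hp
    have h5 := hrefl y h1
    have hz : ∀ i : {i // i ∉ H}, (if h : (i : ι) ∈ H then t - y ⟨i, h⟩ else z ⟨i, h⟩) = z i :=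
      fun i => dif_neg i.2
    have hy : ∀ i : {i // i ∈ H}, (if h : (i : ι) ∈ H then t - y ⟨i, h⟩ else z ⟨i, h⟩) = t - y i :=
      fun i => dif_pos i.2
    simp only [Finset.coe_filter, Set.mem_ofPred_eq, mem_boxSlice, hcompl, hsplit, hy, hz]
    refine ⟨⟨fun i => ?_, by omega⟩, h4⟩
    split_ifs with h
    · exact Nat.sub_le _ _
    · exact h3 _
  · intro x hx
    simp only [Finset.coe_filter, Set.mem_ofPred_eq, mem_boxSlice] at hx
    funext i
    have := hx.1.1 i
    dsimp only
    split_ifs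
    · omega
    · rfl
  · rintro ⟨y, z⟩ hp
    simp only [Finset.coe_product, Set.mem_prod, Finset.mem_coe, mem_boxSlice] at hp
    ext i
    · simp only [i.2, dif_pos]
      exact Nat.sub_sub_self (hp.1.1 i)
    · simp only [i.2, not_false_eq_true, dif_neg]

/-- The cutoff `b` serves both formulas: d = s - r, b = d + 1 on a hyperplane, and d = b = r, m = 0
for the hypersimplex. -/
theorem card_boxSlice_mul_add (ι : Type*) [Fintype ι] [DecidableEq ι] {t d m s b : ℕ}
    (hs : Fintype.card ι = s) (hs1 : 1 ≤ s) (hbs : b ≤ s) (hbd : b ≤ d + 1)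
    (hb : t * d + m < b * (t + 1)) :
    ((boxSlice ι t (t * d + m)).card : ℤ) = ∑ i ∈ Finset.range b,
      (-1 : ℤ) ^ i * (s.choose i : ℤ) *
        ((t * (d - i) + m + s - 1 - i).choose (s - 1) : ℤ) := by
  obtain ⟨q, rfl⟩ := Nat.exists_eq_add_of_le' hs1
  rw [card_boxSlice ι t _ q hs]
  symm
  refine Finset.sum_subset_zero_on_sdiff
    (Finset.range_subset_range.2 (by omega)) (fun i hi => ?_) (fun i hi => ?_)
  · simp only [Finset.mem_sdiff, Finset.mem_range, not_lt] at hi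
    have h1 : b * (t + 1) ≤ i * (t + 1) := Nat.mul_le_mul_right _ hi.2
    rw [if_neg (by omega), mul_zero]
  · rw [Finset.mem_range] at hi
    -- Here i ≤ d, so `d - i` is not truncated. Where the condition i(t + 1) ≤ k fails, the upper
    -- index of the binomial drops below s - 1; i ≤ s - 1 rules out truncation there.
    obtain ⟨e, rfl⟩ := Nat.exists_eq_add_of_le (Nat.lt_succ_iff.1 (hi.trans_le hbd))
    congr 1
    have h1 : t * (i + e) = i * t + t * e := by ring
    have h2 : i * (t + 1) = i * t + i := by ring
    rw [h1, h2, Nat.add_sub_cancel_left]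
    split_ifs with h
    · congr 2
      omega
    · rw [Nat.choose_eq_zero_of_lt (by omega), Nat.cast_zero]

/-- The points of a slice of a box that violate the inequality of `H`. -/
theorem card_filter_not_le {ι : Type*} [Fintype ι] [DecidableEq ι] (H : Finset ι) {t r : ℕ}
    (hr : 1 ≤ r) (hrH : r ≤ H.card) (hH : H.card < Fintype.card ι) :
    (((boxSlice ι t (t * r)).filter fun x => ¬ ∑ i ∈ H, x i + t ≤ t * r).card : ℤ)
      = ∑ m ∈ Finset.range t, ∑ i ∈ Finset.range (H.card - r + 1),
          (-1 : ℤ) ^ i * (H.card.choose i : ℤ) *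
            ((t * (H.card - r - i) + m + H.card - 1 - i).choose (H.card - 1) : ℤ) *
            ((m + Fintype.card ι - H.card - 1).choose m : ℤ) := by
  have hcomp : ∀ x : ι → ℕ, ∑ i ∈ H, x i + ∑ i with i ∉ H, x i = ∑ i, x i := by
    intro x
    rw [← Finset.sum_filter_add_sum_filter_not Finset.univ (· ∈ H)]
    simp
  rw [Finset.card_eq_sum_card_fiberwise (f := fun x => ∑ i with i ∉ H, x i)
    (t := Finset.range t), Nat.cast_sum]
  · refine Finset.sum_congr rfl fun m hm => ?_
    rw [Finset.mem_range] at hm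
    rw [← Finset.sum_mul, ← card_boxSlice_mul_add {i // i ∈ H} (by simp) (by omega)
      (by omega) le_rfl (by nlinarith)]
    have h1 : Fintype.card {i // i ∉ H} = Fintype.card ι - H.card - 1 + 1 := by
      rw [Fintype.card_subtype_compl, Fintype.card_coe]
      omega
    have h2 : m + Fintype.card ι - H.card - 1 = m + (Fintype.card ι - H.card - 1) := by omega
    rw [h2, ← card_boxSlice_of_le {i // i ∉ H} t m _ h1 hm.le, ← Nat.cast_mul,
      ← card_filter_boxSlice H (K := t * r), Finset.filter_filter]
    · congr 2
      refine Finset.filter_congr fun x hx => ?_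
      have := hcomp x
      rw [(mem_boxSlice.1 hx).2] at this
      constructor
      · exact And.right
      · exact fun h => ⟨by omega, h⟩
    · obtain ⟨e, he⟩ := Nat.exists_eq_add_of_le hrH
      rw [he, Nat.add_sub_cancel_left]
      ring
  -- With total sum tr, violating the inequality of H means exactly that the sum outside H is below
  -- t.
  · intro x hx
    simp only [Finset.coe_filter, Set.mem_ofPred_eq, mem_boxSlice] at hx
    have := hcomp x
    simp only [Finset.coe_range, Set.mem_Iio]
    omega

/-! ### Summing over hyperplanes. -/

namespace Matroid

open Classical in
theorem numHyperplanes_eq_card {α : Type*} [Fintype α] (M : Matroid α) (s : ℕ) :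
    M.numHyperplanes s =
      (Finset.univ.filter fun H : Finset α => M.IsHyperplane H ∧ H.card = s).card := by
  rw [numHyperplanes, ← Set.ncard_coe_finset,
    ← Set.ncard_image_of_injective (f := fun H : Finset α => (H : Set α)) _
      Finset.coe_injective]
  congr 1
  ext H
  simp only [Set.mem_ofPred_eq, Finset.coe_filter, Finset.mem_univ, true_and, Set.mem_image]
  constructor
  · rintro ⟨h1, h2⟩
    refine ⟨H.toFinset, ⟨by simpa using h1, ?_⟩, by simp⟩
    rw [Set.encard_eq_coe_toFinset_card] at h2
    exact_mod_cast h2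
  · rintro ⟨H, ⟨h1, h2⟩, rfl⟩
    exact ⟨h1, by rw [Set.encard_coe_eq_coe_finsetCard, h2]⟩

variable {α : Type*} {M : Matroid α} {r : ℕ}

theorem IsHyperplane.ne_univ (hr : M.eRank = r) {H : Set α}
    (hH : M.IsHyperplane H) : H ≠ Set.univ := by
  rintro rfl
  have h := hH.2
  rw [eRk_univ_eq, hr] at h
  have : r + 1 = r := by exact_mod_cast h
  omega

/-- No point of the hypersimplex violates the inequalities of two hyperplanes. -/
theorem IsPaving.eq_of_not_le [Fintype α] [DecidableEq α] (hM : M.IsPaving) (hE : M.E = Set.univ)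
    (hr : M.eRank = r) {t : ℕ} {x : α → ℕ} (hx : x ∈ boxSlice α t (t * r)) {H K : Finset α}
    (hH : M.IsHyperplane H) (hK : M.IsHyperplane K)
    (hxH : ¬ ∑ i ∈ H, x i + t ≤ t * r) (hxK : ¬ ∑ i ∈ K, x i + t ≤ t * r) : H = K := by
  by_contra hne
  have hcard := IsHyperplane.ncard_inter_le hM hE hr hH hK (Finset.coe_injective.ne hne)
  rw [← Finset.coe_inter, Set.ncard_coe_finset] at hcard
  rw [mem_boxSlice] at hx
  -- x(H) + x(K) = x(H ∪ K) + x(H ∩ K) ≤ tr + t(r - 2), while two violations would make it exceed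
  -- 2t(r - 1).
  have h1 := Finset.sum_union_inter (s₁ := H) (s₂ := K) (f := x)
  have h2 : ∑ i ∈ H ∪ K, x i ≤ t * r := by
    rw [← hx.2]
    exact Finset.sum_le_sum_of_subset (Finset.subset_univ _)
  have h3 : ∑ i ∈ H ∩ K, x i ≤ (H ∩ K).card * t := by
    simpa using Finset.sum_le_card_nsmul (H ∩ K) x t fun i _ => hx.1 i
  have h4 : ((H ∩ K).card + 2) * t ≤ r * t := Nat.mul_le_mul_right _ hcard
  rw [mul_comm r t] at h4
  have h5 : ((H ∩ K).card + 2) * t = (H ∩ K).card * t + 2 * t := by ring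
  omega

open Classical in
theorem IsPaving.card_boxSlice_eq [Fintype α] [DecidableEq α] (hM : M.IsPaving) (hE : M.E = Set.univ)
    (hr : M.eRank = r) (t : ℕ) :
    (boxSlice α t (t * r)).card = M.ehr t +
      ∑ H ∈ Finset.univ.filter fun H : Finset α => M.IsHyperplane H ∧ r ≤ H.card,
        ((boxSlice α t (t * r)).filter fun x => ¬ ∑ i ∈ H, x i + t ≤ t * r).card := by
  rw [hM.ehr_eq_card hE hr, ← Finset.card_biUnion]
  · rw [← Finset.card_filter_add_card_filter_not (fun x : α → ℕ =>
      ∀ H : Finset α, M.IsHyperplane H → r ≤ H.card → ∑ i ∈ H, x i + t ≤ t * r)]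
    congr 2
    ext x
    simp only [Finset.mem_filter, Finset.mem_biUnion, Finset.mem_univ, true_and]
    push Not
    constructor
    · rintro ⟨hx, H, h1, h2, h3⟩
      exact ⟨H, ⟨h1, h2⟩, hx, h3⟩
    · rintro ⟨H, ⟨h1, h2⟩, hx, h3⟩
      exact ⟨hx, H, h1, h2, h3⟩
  · intro H hH K hK hne
    rw [Function.onFun, Finset.disjoint_left]
    intro x hxH hxK
    simp only [Finset.coe_filter, Finset.mem_univ, true_and, Set.mem_ofPred_eq] at hH hK
    rw [Finset.mem_filter] at hxH hxK
    exact hne (hM.eq_of_not_le hE hr hxH.1 hH.1 hK.1 hxH.2 hxK.2)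

end Matroid

theorem mainTheorem1 (n r : ℕ) (M : Matroid (Fin n)) (hE : M.E = Set.univ)
    (hr : M.eRank = (r : ℕ∞)) (hM : M.IsPaving) (t : ℕ) :
    ((M.ehr t : ℤ) = ((Matroid.uniform r n).ehr t : ℤ) -
      ∑ s ∈ Finset.Ico r n, (M.numHyperplanes s : ℤ) *
        ∑ m ∈ Finset.range t, ∑ i ∈ Finset.range (s - r + 1),
          (-1 : ℤ) ^ i * (s.choose i : ℤ) *
            ((t * (s - r - i) + m + s - 1 - i).choose (s - 1) : ℤ) *
            ((m + n - s - 1).choose m : ℤ)) ∧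
    (1 ≤ r → ((Matroid.uniform r n).ehr t : ℤ) =
      ∑ j ∈ Finset.range r, (-1 : ℤ) ^ j * (n.choose j : ℤ) *
        (((r - j) * t + n - 1 - j).choose (n - 1) : ℤ)) := by
  classical
  have hrn : r ≤ n := by
    have := M.eRank_le_encard_ground
    rw [hr, hE, Set.encard_univ] at this
    simpa using this
  rw [Matroid.ehr_uniform hrn]
  refine ⟨?_, fun hr1 => ?_⟩
  · rw [hM.card_boxSlice_eq hE hr, Nat.cast_add, eq_sub_iff_add_eq, add_right_inj, Nat.cast_sum,
      ← Finset.sum_fiberwise_of_maps_to (g := Finset.card) (t := Finset.Ico r n)]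
    · refine Finset.sum_congr rfl fun s hs => ?_
      rw [Finset.mem_Ico] at hs
      rw [Matroid.numHyperplanes_eq_card, ← nsmul_eq_mul, Finset.filter_filter,
        ← Finset.sum_const]
      refine Finset.sum_congr ?_ fun H hH => ?_
      · refine Finset.filter_congr fun H _ => ?_
        constructor
        · exact fun h => ⟨⟨h.1, by omega⟩, h.2⟩
        · exact fun h => ⟨h.1.1, h.2⟩
      · obtain ⟨-, ⟨hHyp, -⟩, rfl⟩ := Finset.mem_filter.1 hH
        rw [card_filter_not_le H (hHyp.one_le hr) hs.1 (by simpa using hs.2), Fintype.card_fin]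
    · intro H hH
      obtain ⟨-, hH, hrH⟩ := Finset.mem_filter.1 hH
      rw [Finset.mem_Ico]
      refine ⟨hrH, ?_⟩
      have hlt := (Finset.card_lt_iff_ne_univ H).2 fun h => hH.ne_univ hr (by simp [h])
      rwa [Fintype.card_fin] at hlt
  -- The term j = r is absent because tr < r(t + 1), which needs r ≥ 1.
  · have := card_boxSlice_mul_add (Fin n) (t := t) (d := r) (m := 0) (b := r)
      (Fintype.card_fin n) (hr1.trans hrn) hrn r.le_succ (by nlinarith)
    simpa only [add_zero, mul_comm t] using this
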